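/- Let $\sigma_1,\sigma_2,\sigma_3$ be the Pauli matrices. For a two-qubit state $\rho$ (a positive semidefinite operator on $\mathbb C^2\otimes\mathbb C^2$ of trace one) with marginals $\rho_A=\mathrm{Tr}_B\,\rho$ and $\rho_B=\mathrm{Tr}_A\,\rho$, let $a_i=\mathrm{Tr}(\rho\,\sigma_i\otimes\mathbb 1)$, $b_j=\mathrm{Tr}(\rho\,\mathbb 1\otimes\sigma_j)$, $t_{ij}=\mathrm{Tr}(\rho\,\sigma_i\otimes\sigma_j)$, with lengths $\|\mathbf a\|=(\sum_i a_i^2)^{1/2}$, $\|\mathbf b\|=(\sum_j b_j^2)^{1/2}$, $\|\mathbf T\|=(\sum_{i,j}t_{ij}^2)^{1/2}$. Put $U(x,y)=3+x^2+y^2-4xy-4|x-y|$. (1) The set of triples $(\|\mathbf a\|,\|\mathbf b\|,\|\mathbf T\|)$ attained by two-qubit states is exactly $$\{(x,y,z)\in\mathbb R^3:\ x,y,z\ge 0,\ z\ge x+y-1,\ z^2\le U(x,y)\}.$$ (2) For $p,q\in[0,1]$ and $\{i,j\}=\{0,1\}$ let $$\rho_{\mathrm{ub}}(p,q)=p\,|\phi(q)\rangle\langle\phi(q)|+(1-p)\,|ij\rangle\langle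 ij|,\qquad |\phi(q)\rangle=\sqrt q\,|00\rangle+\sqrt{1-q}\,|11\rangle .$$ This is a state, and it has rank $2$ if and only if $0<p<1$. It satisfies $\|\mathbf T\|^2=U(\|\mathbf a\|,\|\mathbf b\|)$ if and only if $p\max(q,1-q)\ge\tfrac12$ or $p=0$ or $q\in\{0,1\}$. (3) These states attain the whole upper surface: for either choice of $(i,j)\in\{(0,1),(1,0)\}$ and all $x,y\in[0,1]$ there are $p,q\in[0,1]$ such that $\rho_{\mathrm{ub}}(p,q)$ has $\|\mathbf a\|=x$, $\|\mathbf b\|=y$ and $\|\mathbf T\|^2=U(x,y)$, and has rank $2$ if $x\ne y$ and rank $1$ (is pure) if $x=y$. (4) For any two qubit states $\rho_A,\rho_B$ with Bloch vectors $\mathbf a,\mathbf b$ (that is, $a_i=\mathrm{Tr}(\rho_A\sigma_i)$ and $b_j=\mathrm{Tr}(\rho_B\sigma_j)$), put $\Delta=\big|\|\mathbf a\|-\|\mathbf b\|\big|$. Every two-qubit state $\rho$ with marginals $\rho_A,\rho_B$ satisfies $2\,\mathrm{Tr}(\rho^2)\le 2-2\Delta+\Delta^2$, and equality holds for at least one such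 $\rho$. -/

import Mathlib

open scoped Kronecker ComplexOrder

namespace TwoQubit

/-- Operators on one qubit, written in the computational basis. -/
abbrev Op1 := Matrix (Fin 2) (Fin 2) ℂ

/-- Operators on two qubits `A`, `B`, written in the computational product basis. -/
abbrev Op2 := Matrix (Fin 2 × Fin 2) (Fin 2 × Fin 2) ℂ

/-- Density matrices: positive semidefinite of trace one. -/
def IsState {ι : Type} [Fintype ι] (ρ : Matrix ι ι ℂ) : Prop :=
  ρ.PosSemidef ∧ ρ.trace = 1

/-- The Pauli matrices `σ_x, σ_y, σ_z`, indexed by `0, 1, 2`. -/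
def pauli : Fin 3 → Op1 :=
  ![!![0, 1; 1, 0], !![0, -Complex.I; Complex.I, 0], !![1, 0; 0, -1]]

/-- The reduced operator `Tr_B ρ`. -/
def traceB (ρ : Op2) : Op1 := Matrix.of fun i j => ∑ k, ρ (i, k) (j, k)

/-- The reduced operator `Tr_A ρ`. -/
def traceA (ρ : Op2) : Op1 := Matrix.of fun i j => ∑ k, ρ (k, i) (k, j)

/-- The Bloch vector of a qubit, `v_i = Tr(ρ σ_i)`. The trace is real when `ρ` is Hermitian. -/
noncomputable def bloch (ρ : Op1) : EuclideanSpace ℝ (Fin 3) :=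
  WithLp.toLp 2 fun i => (ρ * pauli i).trace.re

/-- The local Bloch vector `a_i = Tr(ρ (σ_i ⊗ 1))` (real when `ρ` is Hermitian). -/
noncomputable def blochA (ρ : Op2) : EuclideanSpace ℝ (Fin 3) :=
  WithLp.toLp 2 fun i => (ρ * (pauli i ⊗ₖ (1 : Op1))).trace.re

/-- The local Bloch vector `b_j = Tr(ρ (1 ⊗ σ_j))` (real when `ρ` is Hermitian). -/
noncomputable def blochB (ρ : Op2) : EuclideanSpace ℝ (Fin 3) :=
  WithLp.toLp 2 fun j => (ρ * ((1 : Op1) ⊗ₖ pauli j)).trace.re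

/-- The correlation tensor `t_ij = Tr(ρ (σ_i ⊗ σ_j))` (real when `ρ` is Hermitian), with the
Euclidean (Hilbert–Schmidt) norm. -/
noncomputable def corr (ρ : Op2) : EuclideanSpace ℝ (Fin 3 × Fin 3) :=
  WithLp.toLp 2 fun ij => (ρ * (pauli ij.1 ⊗ₖ pauli ij.2)).trace.re

/-- The purity `Tr(ρ²)` (real when `ρ` is Hermitian). -/
noncomputable def purity (ρ : Op2) : ℝ := (ρ * ρ).trace.re

/-- The bound for `d Tr(ρ_AB²)`, local dimension `d`, in terms of the difference
`Δ = |‖a‖ - ‖b‖|` of the local Bloch lengths. -/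
noncomputable def purityBound (d : ℕ) (Δ : ℝ) : ℝ := d - √(2 * d) * Δ + Δ ^ 2

/-- The upper bound for `‖T_AB‖²` in terms of `x = ‖a‖`, `y = ‖b‖`. -/
noncomputable def upperBound (x y : ℝ) : ℝ := 3 + x ^ 2 + y ^ 2 - 4 * x * y - 4 * |x - y|

/-- The two-qubit Bloch body: the triples `(‖a‖, ‖b‖, ‖T_AB‖)` attained by states. -/
noncomputable def blochBody : Set (ℝ × ℝ × ℝ) :=
  {v | ∃ ρ : Op2, IsState ρ ∧ v = (‖blochA ρ‖, ‖blochB ρ‖, ‖corr ρ‖)}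

/-- The computational basis vector `|ij⟩`. -/
noncomputable def ket (i j : Fin 2) : Fin 2 × Fin 2 → ℂ := Pi.single (i, j) 1

/-- The rank-one operator `|v⟩⟨v|`. -/
noncomputable def ketbra (v : Fin 2 × Fin 2 → ℂ) : Op2 := Matrix.vecMulVec v (star v)

/-- The vector `|φ(q)⟩ = √q |00⟩ + √(1-q) |11⟩`. -/
noncomputable def phi (q : ℝ) : Fin 2 × Fin 2 → ℂ :=
  ((√q : ℝ) : ℂ) • ket 0 0 + ((√(1 - q) : ℝ) : ℂ) • ket 1 1

/-- The operator `p |φ(q)⟩⟨φ(q)| + (1-p) |ij⟩⟨ij|`. -/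
noncomputable def rhoUb (p q : ℝ) (i j : Fin 2) : Op2 :=
  (p : ℂ) • ketbra (phi q) + ((1 - p : ℝ) : ℂ) • ketbra (ket i j)

end TwoQubit

/-!
The squared Hilbert–Schmidt norm in the Pauli basis gives
`4 Tr ρ² = 1 + ‖a‖² + ‖b‖² + ‖T‖²` (`four_mul_purity`), so `‖T‖² ≤ U(‖a‖, ‖b‖)` and
`2 Tr ρ² ≤ 2 - 2Δ + Δ²` with `Δ = |‖a‖ - ‖b‖|` are the same inequality.

The purity bound (`IsState.two_mul_purity_le`) comes from the largest eigenvalue `l`. Split off the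
corresponding pure state, whose two Bloch vectors have equal length
(`norm_blochA_ketbra_eq_blochB`). The remainder has trace `1 - l` and changes each length by at most
`1 - l`, hence `Δ ≤ 2 (1 - l)`. As `Tr ρ² ≤ max (1 / 2, l² + (1 - l)²)`, this bounds the purity. The
lower bound `‖T‖ ≥ ‖a‖ + ‖b‖ - 1` is the positivity of the expectation value of
`(1 - u · σ) ⊗ (1 - v · σ)`, with `u`, `v` the directions of `a`, `b`
(`IsState.add_sub_one_le_norm_corr`).

For the family `rhoUb`, put `m = p (2q - 1)` and `n = 1 - p`. The Bloch vectors are `m ± n` along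
the third axis, and `U - ‖T‖²` is zero if `n ≤ |m|` and `8 (n - |m|) (1 - n - |m|)` otherwise
(`upperBound_abs_of_le`, `upperBound_abs_of_ge`). This gives the saturation criterion, and solving
`|m + n| = x`, `|m - n| = y` within `n ≤ |m|` shows that the whole upper surface is attained. The
rank is the one of the Gram matrix `diagonal ![p, 1 - p]` of the two orthogonal summands.

Points between the two surfaces are attained on the segment from a diagonal state on the lower
surface to an extremal state with the same Bloch vectors, by the intermediate value theorem
(`exists_isState_of_le_of_le`). Arbitrary marginals in the purity bound are reached by local
unitaries (`exists_purity_eq`).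
-/

namespace TwoQubit

/-! ### Bloch vectors, correlations and purity -/

theorem sq_norm_blochA (ρ : Op2) : ‖blochA ρ‖ ^ 2 =
    (ρ (0, 0) (1, 0) + ρ (0, 1) (1, 1) + ρ (1, 0) (0, 0) + ρ (1, 1) (0, 1)).re ^ 2 +
    (ρ (1, 0) (0, 0) + ρ (1, 1) (0, 1) - ρ (0, 0) (1, 0) - ρ (0, 1) (1, 1)).im ^ 2 +
    (ρ (0, 0) (0, 0) + ρ (0, 1) (0, 1) - ρ (1, 0) (1, 0) - ρ (1, 1) (1, 1)).re ^ 2 := by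
  simp only [EuclideanSpace.real_norm_sq_eq, Fin.sum_univ_three, blochA, pauli, Matrix.trace,
    Matrix.diag, Matrix.mul_apply, Fintype.sum_prod_type, Fin.sum_univ_two,
    Matrix.kroneckerMap_apply]
  simp
  ring

theorem sq_norm_blochB (ρ : Op2) : ‖blochB ρ‖ ^ 2 =
    (ρ (0, 0) (0, 1) + ρ (1, 0) (1, 1) + ρ (0, 1) (0, 0) + ρ (1, 1) (1, 0)).re ^ 2 +
    (ρ (0, 1) (0, 0) + ρ (1, 1) (1, 0) - ρ (0, 0) (0, 1) - ρ (1, 0) (1, 1)).im ^ 2 +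
    (ρ (0, 0) (0, 0) + ρ (1, 0) (1, 0) - ρ (0, 1) (0, 1) - ρ (1, 1) (1, 1)).re ^ 2 := by
  simp only [EuclideanSpace.real_norm_sq_eq, Fin.sum_univ_three, blochB, pauli, Matrix.trace,
    Matrix.diag, Matrix.mul_apply, Fintype.sum_prod_type, Fin.sum_univ_two,
    Matrix.kroneckerMap_apply]
  simp
  ring

theorem sq_norm_bloch (ρ : Op1) : ‖bloch ρ‖ ^ 2 =
    (ρ 0 1 + ρ 1 0).re ^ 2 + (ρ 1 0 - ρ 0 1).im ^ 2 + (ρ 0 0 - ρ 1 1).re ^ 2 := by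
  simp only [EuclideanSpace.real_norm_sq_eq, Fin.sum_univ_three, bloch, pauli, Matrix.trace,
    Matrix.diag, Matrix.mul_apply, Fin.sum_univ_two]
  simp
  ring

theorem bloch_traceB (ρ : Op2) : bloch (traceB ρ) = blochA ρ := by
  ext i
  simp only [bloch, blochA, Matrix.trace, Matrix.diag, Matrix.mul_apply, Fintype.sum_prod_type,
    Fin.sum_univ_two, Matrix.kroneckerMap_apply, traceB, Matrix.of_apply, Matrix.one_apply]
  simp
  ring

theorem bloch_traceA (ρ : Op2) : bloch (traceA ρ) = blochB ρ := by
  ext i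
  simp only [bloch, blochB, Matrix.trace, Matrix.diag, Matrix.mul_apply, Fintype.sum_prod_type,
    Fin.sum_univ_two, Matrix.kroneckerMap_apply, traceA, Matrix.of_apply, Matrix.one_apply]
  simp
  ring

/-- The Pauli products are an orthogonal basis of the Hermitian operators, so the purity of a state
is determined by the three lengths. This is what makes the purity bound and the upper bound on
`‖corr ρ‖` the same inequality. -/
theorem four_mul_purity {ρ : Op2} (h : ρ.IsHermitian) : 4 * purity ρ =
    ρ.trace.re ^ 2 + ‖blochA ρ‖ ^ 2 + ‖blochB ρ‖ ^ 2 + ‖corr ρ‖ ^ 2 := by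
  have hr : ∀ i j, (ρ j i).re = (ρ i j).re := fun i j => by
    rw [← h.apply i j]; simp
  have hi : ∀ i j, (ρ j i).im = -(ρ i j).im := fun i j => by
    rw [← h.apply i j]; simp
  have d : ∀ i, (ρ i i).im = 0 := fun i => by linarith [hi i i]
  rw [sq_norm_blochA, sq_norm_blochB]
  simp only [EuclideanSpace.real_norm_sq_eq, Fin.sum_univ_three, corr, pauli, Matrix.trace,
    Matrix.diag, Matrix.mul_apply, Fintype.sum_prod_type, Fin.sum_univ_two, purity,
    Matrix.kroneckerMap_apply]
  simp [hr (0, 0) (0, 1), hr (0, 0) (1, 0), hr (0, 0) (1, 1), hr (0, 1) (1, 0), hr (0, 1) (1, 1),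
    hr (1, 0) (1, 1), hi (0, 0) (0, 1), hi (0, 0) (1, 0), hi (0, 0) (1, 1), hi (0, 1) (1, 0),
    hi (0, 1) (1, 1), hi (1, 0) (1, 1), d]
  ring

theorem blochA_add (ρ τ : Op2) : blochA (ρ + τ) = blochA ρ + blochA τ := by
  ext i; simp [blochA, add_mul]

theorem blochB_add (ρ τ : Op2) : blochB (ρ + τ) = blochB ρ + blochB τ := by
  ext i; simp [blochB, add_mul]

theorem corr_add (ρ τ : Op2) : corr (ρ + τ) = corr ρ + corr τ := by
  ext i; simp [corr, add_mul]

theorem blochA_smul (r : ℝ) (ρ : Op2) : blochA (r • ρ) = r • blochA ρ := by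
  ext i; simp [blochA]

theorem blochB_smul (r : ℝ) (ρ : Op2) : blochB (r • ρ) = r • blochB ρ := by
  ext i; simp [blochB]

theorem corr_smul (r : ℝ) (ρ : Op2) : corr (r • ρ) = r • corr ρ := by
  ext i; simp [corr]

/-- For a unit vector this is `1 - C²`, where `C` is the concurrence. The expression is symmetric
under exchange of the two qubits, so pure states have equal local Bloch lengths. -/
theorem sq_norm_blochA_ketbra (v : Fin 2 × Fin 2 → ℂ) : ‖blochA (ketbra v)‖ ^ 2 =
    (∑ k, ‖v k‖ ^ 2) ^ 2 - 4 * ‖v (0, 0) * v (1, 1) - v (0, 1) * v (1, 0)‖ ^ 2 := by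
  rw [sq_norm_blochA]
  simp only [Fintype.sum_prod_type, Fin.sum_univ_two, Complex.sq_norm, Complex.normSq_apply,
    ketbra, Matrix.vecMulVec_apply]
  simp
  ring

theorem sq_norm_blochB_ketbra (v : Fin 2 × Fin 2 → ℂ) : ‖blochB (ketbra v)‖ ^ 2 =
    (∑ k, ‖v k‖ ^ 2) ^ 2 - 4 * ‖v (0, 0) * v (1, 1) - v (0, 1) * v (1, 0)‖ ^ 2 := by
  rw [sq_norm_blochB]
  simp only [Fintype.sum_prod_type, Fin.sum_univ_two, Complex.sq_norm, Complex.normSq_apply,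
    ketbra, Matrix.vecMulVec_apply]
  simp
  ring

/-! ### Necessity of the bounds -/

open Matrix in
theorem trace_conj_mul_conj {n : Type*} [Fintype n] [DecidableEq n] {U : Matrix n n ℂ}
    (hU : Uᴴ * U = 1) (D : Matrix n n ℂ) :
    ((U * D * Uᴴ) * (U * D * Uᴴ)).trace = (D * D).trace := by
  have h : (U * D * Uᴴ) * (U * D * Uᴴ) = U * (D * (Uᴴ * U) * D * Uᴴ) := by noncomm_ring
  rw [h, Matrix.trace_mul_comm, hU, mul_assoc, hU, mul_one, mul_one]

/-- The spectral decomposition of a state into pure states with weights its eigenvalues. -/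
theorem IsState.exists_eq_sum_ketbra {ρ : Op2} (h : IsState ρ) :
    ∃ (l : Fin 2 × Fin 2 → ℝ) (v : Fin 2 × Fin 2 → Fin 2 × Fin 2 → ℂ), (∀ i, 0 ≤ l i) ∧
      ∑ i, l i = 1 ∧ (∀ i, ∑ k, ‖v i k‖ ^ 2 = 1) ∧ ρ = ∑ i, l i • ketbra (v i) ∧
      purity ρ = ∑ i, l i ^ 2 := by
  obtain ⟨hp, ht⟩ := h
  have hU := (Unitary.mem_iff.1 hp.1.eigenvectorUnitary.2).1
  have hs := hp.1.spectral_theorem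
  rw [Unitary.conjStarAlgAut_apply] at hs
  refine ⟨hp.1.eigenvalues, fun i k => (hp.1.eigenvectorUnitary : Op2) k i,
    hp.eigenvalues_nonneg, ?_, fun i => ?_, ?_, ?_⟩
  · have := hp.1.trace_eq_sum_eigenvalues
    rw [ht] at this
    exact Complex.ofReal_injective (by simpa using this.symm)
  · simp only [Matrix.IsHermitian.eigenvectorUnitary_apply]
    rw [← EuclideanSpace.norm_sq_eq]
    simp
  · conv_lhs => rw [hs]
    ext a b
    simp only [Matrix.mul_apply, Matrix.sum_apply, Matrix.smul_apply, ketbra,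
      Matrix.vecMulVec_apply, Matrix.diagonal_apply, Matrix.star_apply]
    refine Finset.sum_congr rfl fun i _ => ?_
    simp
    ring
  · have : (ρ * ρ).trace = ∑ i, ((hp.1.eigenvalues i : ℂ)) ^ 2 := by
      conv_lhs => rw [hs]
      exact (trace_conj_mul_conj hU _).trans (by simp [Matrix.trace, pow_two])
    rw [purity, this]
    norm_cast

theorem norm_blochA_ketbra_eq_blochB (v : Fin 2 × Fin 2 → ℂ) :
    ‖blochA (ketbra v)‖ = ‖blochB (ketbra v)‖ := by
  rw [← sq_eq_sq₀ (norm_nonneg _) (norm_nonneg _), sq_norm_blochA_ketbra, sq_norm_blochB_ketbra]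

theorem norm_blochA_ketbra_le {v : Fin 2 × Fin 2 → ℂ} (hv : ∑ k, ‖v k‖ ^ 2 = 1) :
    ‖blochA (ketbra v)‖ ≤ 1 := by
  rw [← sq_le_one_iff₀ (norm_nonneg _), sq_norm_blochA_ketbra, hv]
  nlinarith [sq_nonneg ‖v (0, 0) * v (1, 1) - v (0, 1) * v (1, 0)‖]

theorem norm_blochB_ketbra_le {v : Fin 2 × Fin 2 → ℂ} (hv : ∑ k, ‖v k‖ ^ 2 = 1) :
    ‖blochB (ketbra v)‖ ≤ 1 :=
  (norm_blochA_ketbra_eq_blochB v).symm.trans_le (norm_blochA_ketbra_le hv)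

theorem blochA_sum {ι : Type*} (s : Finset ι) (f : ι → Op2) :
    blochA (∑ i ∈ s, f i) = ∑ i ∈ s, blochA (f i) :=
  map_sum (AddMonoidHom.mk' blochA blochA_add) f s

theorem blochB_sum {ι : Type*} (s : Finset ι) (f : ι → Op2) :
    blochB (∑ i ∈ s, f i) = ∑ i ∈ s, blochB (f i) :=
  map_sum (AddMonoidHom.mk' blochB blochB_add) f s

/-- Let `l m` be the largest eigenvalue. Its eigenvector contributes equally to both Bloch lengths
and the rest of the state has trace `1 - l m`, so `Δ ≤ 2 * (1 - l m)`: unequal Bloch lengths force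
the largest eigenvalue, and with it the purity, away from one. -/
theorem IsState.two_mul_purity_le {ρ : Op2} (h : IsState ρ) :
    2 * purity ρ ≤ 2 - 2 * |‖blochA ρ‖ - ‖blochB ρ‖| + |‖blochA ρ‖ - ‖blochB ρ‖| ^ 2 := by
  classical
  obtain ⟨l, v, hl, hsum, hv, rfl, hpur⟩ := h.exists_eq_sum_ketbra
  obtain ⟨m, -, hm⟩ := Finset.exists_max_image Finset.univ l Finset.univ_nonempty
  have hrest : ∑ i ∈ Finset.univ.erase m, l i = 1 - l m := by
    rw [← hsum, ← Finset.add_sum_erase _ _ (Finset.mem_univ m)]; ring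
  -- Either Bloch length differs from that of the dominant pure part by at most the other weights.
  have key : ∀ f : Op2 → EuclideanSpace ℝ (Fin 3),
      (∀ (s : Finset (Fin 2 × Fin 2)) (g : Fin 2 × Fin 2 → Op2),
        f (∑ i ∈ s, g i) = ∑ i ∈ s, f (g i)) →
      (∀ (r : ℝ) (τ), f (r • τ) = r • f τ) → (∀ i, ‖f (ketbra (v i))‖ ≤ 1) →
      |‖f (∑ i, l i • ketbra (v i))‖ - l m * ‖f (ketbra (v m))‖| ≤ 1 - l m := by
    intro f hadd hsmul hf
    have h1 : l m * ‖f (ketbra (v m))‖ = ‖f (l m • ketbra (v m))‖ := by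
      rw [hsmul, norm_smul, Real.norm_of_nonneg (hl m)]
    rw [h1]
    refine (abs_norm_sub_norm_le _ _).trans ?_
    rw [hadd, ← Finset.add_sum_erase _ _ (Finset.mem_univ m), add_sub_cancel_left, ← hrest]
    refine norm_sum_le_of_le _ fun i _ => ?_
    rw [hsmul, norm_smul, Real.norm_of_nonneg (hl i)]
    exact mul_le_of_le_one_right (hl i) (hf i)
  have hA := key blochA blochA_sum blochA_smul fun i => norm_blochA_ketbra_le (hv i)
  have hB := key blochB blochB_sum blochB_smul fun i => norm_blochB_ketbra_le (hv i)
  rw [norm_blochA_ketbra_eq_blochB] at hA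
  rw [hpur]
  generalize hx : ‖blochA (∑ i, l i • ketbra (v i))‖ = x at *
  generalize hy : ‖blochB (∑ i, l i • ketbra (v i))‖ = y at *
  have hD : |x - y| ≤ 2 * (1 - l m) := by
    rw [abs_le] at *
    constructor <;> linarith
  have hm0 := hl m
  have hD1 : |x - y| ≤ 1 := by
    have hr : l m * ‖blochB (ketbra (v m))‖ ≤ l m :=
      mul_le_of_le_one_right (hl m) (norm_blochB_ketbra_le (hv m))
    have hx0 : 0 ≤ x := hx ▸ norm_nonneg _
    have hy0 : 0 ≤ y := hy ▸ norm_nonneg _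
    rw [abs_le] at *
    constructor <;> linarith
  -- For `1 / 2 ≤ l m` the purity is largest when the remaining weight sits on one eigenvector.
  -- For `l m ≤ 1 / 2` the purity is at most `1 / 2`, and the bound is never smaller than that.
  rcases le_total (1 / 2) (l m) with h2 | h2
  · have hP : ∑ i, l i ^ 2 ≤ l m ^ 2 + (1 - l m) ^ 2 := by
      rw [← Finset.add_sum_erase _ _ (Finset.mem_univ m), ← hrest]
      gcongr
      exact Finset.sum_sq_le_sq_sum_of_nonneg fun i _ => hl i
    nlinarith [mul_nonneg (sub_nonneg.2 hD) (by linarith : 0 ≤ 2 * l m - |x - y|)]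
  · have hP : ∑ i, l i ^ 2 ≤ l m := by
      calc ∑ i, l i ^ 2 ≤ ∑ i, l m * l i := Finset.sum_le_sum fun i hi => by
            rw [pow_two]; exact mul_le_mul_of_nonneg_right (hm i hi) (hl i)
        _ = l m := by rw [← Finset.mul_sum, hsum, mul_one]
    nlinarith [sq_nonneg (1 - |x - y|)]

theorem IsState.sq_norm_corr_le {ρ : Op2} (h : IsState ρ) :
    ‖corr ρ‖ ^ 2 ≤ upperBound ‖blochA ρ‖ ‖blochB ρ‖ := by
  have h1 := h.two_mul_purity_le
  have h2 := four_mul_purity h.1.1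
  rw [h.2, Complex.one_re] at h2
  rw [sq_abs] at h1
  rw [upperBound]
  linarith

/-- The operator `1 - u · σ`. -/
noncomputable def oneSubBloch (u : EuclideanSpace ℝ (Fin 3)) : Op1 :=
  !![1 - u 2, -u 0 + Complex.I * u 1; -u 0 - Complex.I * u 1, 1 + u 2]

theorem oneSubBloch_isHermitian (u : EuclideanSpace ℝ (Fin 3)) : (oneSubBloch u).IsHermitian := by
  ext i j
  fin_cases i <;> fin_cases j <;> simp [oneSubBloch, sub_eq_add_neg]

theorem oneSubBloch_mul_self {u : EuclideanSpace ℝ (Fin 3)} (hu : ‖u‖ = 1) :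
    oneSubBloch u * oneSubBloch u = (2 : ℂ) • oneSubBloch u := by
  have h : ((u 0 : ℝ) : ℂ) ^ 2 + (u 1 : ℝ) ^ 2 + (u 2 : ℝ) ^ 2 = 1 := by
    have := EuclideanSpace.real_norm_sq_eq u
    rw [hu, Fin.sum_univ_three] at this
    exact_mod_cast (this.symm.trans (one_pow 2))
  ext i j
  fin_cases i <;> fin_cases j <;> simp [oneSubBloch, Matrix.mul_apply]
  · linear_combination h - (u 1 : ℂ) ^ 2 * Complex.I_sq
  · ring
  · ring
  · linear_combination h - (u 1 : ℂ) ^ 2 * Complex.I_sq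

/-- For unit `u` the operator is twice a projection. -/
theorem oneSubBloch_posSemidef {u : EuclideanSpace ℝ (Fin 3)} (hu : ‖u‖ = 1) :
    (oneSubBloch u).PosSemidef := by
  have h := (Matrix.posSemidef_self_mul_conjTranspose (oneSubBloch u)).smul
    (show (0 : ℂ) ≤ 1 / 2 by simp)
  rwa [(oneSubBloch_isHermitian u).eq, oneSubBloch_mul_self hu, smul_smul, one_div,
    inv_mul_cancel₀ two_ne_zero, one_smul] at h

/-- The Pauli expansion of the expectation value of `(1 - u · σ) ⊗ (1 - v · σ)`. -/
theorem trace_mul_oneSubBloch_kronecker (ρ : Op2) (u v : EuclideanSpace ℝ (Fin 3)) :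
    (ρ * (oneSubBloch u ⊗ₖ oneSubBloch v)).trace.re =
      ρ.trace.re - ∑ i, u i * blochA ρ i - ∑ j, v j * blochB ρ j +
        ∑ ij : Fin 3 × Fin 3, u ij.1 * v ij.2 * corr ρ ij := by
  simp only [Fin.sum_univ_three, blochA, blochB, corr, pauli, Matrix.trace, oneSubBloch,
    Matrix.diag, Matrix.mul_apply, Fintype.sum_prod_type, Fin.sum_univ_two,
    Matrix.kroneckerMap_apply]
  simp
  ring

open scoped MatrixOrder in
theorem trace_mul_re_nonneg {n : Type*} [Fintype n] {A B : Matrix n n ℂ} (hA : A.PosSemidef)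
    (hB : B.PosSemidef) : 0 ≤ (A * B).trace.re := by
  classical
  obtain ⟨K, rfl⟩ := CStarAlgebra.nonneg_iff_eq_star_mul_self.1 hB.nonneg
  rw [← mul_assoc, Matrix.trace_mul_comm, ← mul_assoc]
  exact (Complex.nonneg_iff.1 (hA.mul_mul_conjTranspose_same K).trace_nonneg).1

/-- A unit vector in the direction of `a`, an arbitrary one if `a = 0`. -/
theorem exists_norm_eq_one_sum_mul_eq (a : EuclideanSpace ℝ (Fin 3)) :
    ∃ u : EuclideanSpace ℝ (Fin 3), ‖u‖ = 1 ∧ ∑ i, u i * a i = ‖a‖ := by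
  rcases eq_or_ne a 0 with rfl | ha
  · exact ⟨EuclideanSpace.single 0 1, by simp, by simp⟩
  · refine ⟨‖a‖⁻¹ • a, ?_, ?_⟩
    · rw [norm_smul, norm_inv, norm_norm, inv_mul_cancel₀ (norm_ne_zero_iff.2 ha)]
    · have h : ‖a‖ ≠ 0 := norm_ne_zero_iff.2 ha
      simp only [PiLp.smul_apply, smul_eq_mul, mul_assoc, ← Finset.mul_sum, ← pow_two]
      rw [← EuclideanSpace.real_norm_sq_eq]
      field_simp

/-- With `u`, `v` the directions of the local Bloch vectors, the expectation value of the positive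
operator `(1 - u · σ) ⊗ (1 - v · σ)` is `1 - ‖a‖ - ‖b‖ + ⟨u ⊗ v, T⟩`. -/
theorem IsState.add_sub_one_le_norm_corr {ρ : Op2} (h : IsState ρ) :
    ‖blochA ρ‖ + ‖blochB ρ‖ - 1 ≤ ‖corr ρ‖ := by
  obtain ⟨u, hu, hua⟩ := exists_norm_eq_one_sum_mul_eq (blochA ρ)
  obtain ⟨v, hv, hvb⟩ := exists_norm_eq_one_sum_mul_eq (blochB ρ)
  have h0 := trace_mul_re_nonneg h.1
    ((oneSubBloch_posSemidef hu).kronecker (oneSubBloch_posSemidef hv))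
  rw [trace_mul_oneSubBloch_kronecker, h.2, hua, hvb, Complex.one_re] at h0
  have h1 := real_inner_le_norm (corr ρ)
    (WithLp.toLp 2 fun ij : Fin 3 × Fin 3 => u ij.1 * v ij.2)
  have h2 : ‖(WithLp.toLp 2 fun ij : Fin 3 × Fin 3 => u ij.1 * v ij.2 :
      EuclideanSpace ℝ (Fin 3 × Fin 3))‖ = 1 := by
    rw [← sq_eq_sq₀ (norm_nonneg _) zero_le_one, EuclideanSpace.real_norm_sq_eq]
    simp only [mul_pow, Fintype.sum_prod_type, ← Finset.mul_sum, ← Finset.sum_mul]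
    rw [← EuclideanSpace.real_norm_sq_eq, ← EuclideanSpace.real_norm_sq_eq, hu, hv]
    norm_num
  rw [h2, mul_one] at h1
  simp only [PiLp.inner_apply, RCLike.inner_apply, conj_trivial] at h1
  linarith

/-! ### The extremal family -/

open Matrix

/-- The matrix with the two columns `√p |φ(q)⟩` and `√(1-p) |ij⟩`. -/
noncomputable def rhoUbFactor (p q : ℝ) (i j : Fin 2) : Matrix (Fin 2 × Fin 2) (Fin 2) ℂ :=
  of fun k c => ![(√p : ℂ) * phi q k, (√(1 - p) : ℂ) * ket i j k] c

theorem rhoUb_eq_mul {p q : ℝ} (hp : p ∈ Set.Icc (0 : ℝ) 1) (i j : Fin 2) :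
    rhoUb p q i j = rhoUbFactor p q i j * (rhoUbFactor p q i j)ᴴ := by
  have h1 : (√p : ℂ) ^ 2 = p := by exact_mod_cast Real.sq_sqrt hp.1
  have h2 : (√(1 - p) : ℂ) ^ 2 = ((1 - p : ℝ) : ℂ) := by
    exact_mod_cast Real.sq_sqrt (sub_nonneg.2 hp.2)
  ext a b
  simp only [rhoUb, ketbra, rhoUbFactor, Matrix.mul_apply, Fin.sum_univ_two, conjTranspose_apply,
    Matrix.add_apply, Matrix.smul_apply, vecMulVec_apply, of_apply, ← h1, ← h2]
  simp
  ring

/-- The Gram matrix of the two columns. It has the same rank and trace as `rhoUb p q i j`. -/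
theorem conjTranspose_rhoUbFactor_mul {p q : ℝ} (hp : p ∈ Set.Icc (0 : ℝ) 1)
    (hq : q ∈ Set.Icc (0 : ℝ) 1) {i j : Fin 2} (hij : i ≠ j) :
    (rhoUbFactor p q i j)ᴴ * rhoUbFactor p q i j = diagonal ![(p : ℂ), ((1 - p : ℝ) : ℂ)] := by
  have h1 : (√p : ℂ) ^ 2 = p := by exact_mod_cast Real.sq_sqrt hp.1
  have h2 : (√(1 - p) : ℂ) ^ 2 = ((1 - p : ℝ) : ℂ) := by
    exact_mod_cast Real.sq_sqrt (sub_nonneg.2 hp.2)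
  have h3 : (√q : ℂ) ^ 2 = q := by exact_mod_cast Real.sq_sqrt hq.1
  have h4 : (√(1 - q) : ℂ) ^ 2 = ((1 - q : ℝ) : ℂ) := by
    exact_mod_cast Real.sq_sqrt (sub_nonneg.2 hq.2)
  push_cast at h2 h4
  ext a b
  fin_cases i <;> fin_cases j <;> first | exact absurd rfl hij | skip
  all_goals
    fin_cases a <;> fin_cases b <;>
      simp [rhoUbFactor, Matrix.mul_apply, Fintype.sum_prod_type, phi, ket, Pi.single_apply]
  all_goals first
    | linear_combination h2
    | linear_combination h1 + (√p : ℂ) ^ 2 * h3 + (√p : ℂ) ^ 2 * h4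

theorem isState_rhoUb {p q : ℝ} (hp : p ∈ Set.Icc (0 : ℝ) 1)
    (hq : q ∈ Set.Icc (0 : ℝ) 1) {i j : Fin 2} (hij : i ≠ j) : IsState (rhoUb p q i j) := by
  rw [rhoUb_eq_mul hp]
  refine ⟨posSemidef_self_mul_conjTranspose _, ?_⟩
  rw [trace_mul_comm, conjTranspose_rhoUbFactor_mul hp hq hij]
  simp [Matrix.trace]

theorem rank_rhoUb {p q : ℝ} (hp : p ∈ Set.Icc (0 : ℝ) 1)
    (hq : q ∈ Set.Icc (0 : ℝ) 1) {i j : Fin 2} (hij : i ≠ j) :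
    (rhoUb p q i j).rank = if 0 < p ∧ p < 1 then 2 else 1 := by
  classical
  have hp1 : (1 - (p : ℂ) = 0) ↔ p = 1 := by
    rw [sub_eq_zero, eq_comm]; norm_cast
  rw [rhoUb_eq_mul hp, rank_self_mul_conjTranspose, ← rank_conjTranspose_mul_self,
    conjTranspose_rhoUbFactor_mul hp hq hij, rank_diagonal, Fintype.card_subtype,
    Finset.card_filter, Fin.sum_univ_two]
  obtain ⟨h0, h1⟩ := hp
  rcases h0.eq_or_lt with rfl | h0
  · simp
  · rcases h1.eq_or_lt with rfl | h1
    · simp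
    · simp [h0, h1, h0.ne', hp1, h1.ne]

theorem blochA_rhoUb {p q : ℝ} (hq : q ∈ Set.Icc (0 : ℝ) 1) {i j : Fin 2} (hij : i ≠ j) :
    blochA (rhoUb p q i j) =
      EuclideanSpace.single 2 (p * (2 * q - 1) + (1 - p) * (-1) ^ (i : ℕ)) := by
  have h3 := Real.mul_self_sqrt hq.1
  have h4 := Real.mul_self_sqrt (sub_nonneg.2 hq.2)
  ext k
  simp only [blochA, rhoUb, ketbra, phi, Matrix.trace, Matrix.diag, Matrix.mul_apply,
    Fintype.sum_prod_type, Fin.sum_univ_two, Matrix.kroneckerMap_apply]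
  fin_cases i <;> fin_cases j <;> first | exact absurd rfl hij | skip
  all_goals fin_cases k <;> simp [pauli, ket, vecMulVec_apply]
  all_goals linear_combination p * h3 - p * h4

theorem blochB_rhoUb {p q : ℝ} (hq : q ∈ Set.Icc (0 : ℝ) 1) {i j : Fin 2} (hij : i ≠ j) :
    blochB (rhoUb p q i j) =
      EuclideanSpace.single 2 (p * (2 * q - 1) - (1 - p) * (-1) ^ (i : ℕ)) := by
  have h3 := Real.mul_self_sqrt hq.1
  have h4 := Real.mul_self_sqrt (sub_nonneg.2 hq.2)
  ext k
  simp only [blochB, rhoUb, ketbra, phi, Matrix.trace, Matrix.diag, Matrix.mul_apply,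
    Fintype.sum_prod_type, Fin.sum_univ_two, Matrix.kroneckerMap_apply]
  fin_cases i <;> fin_cases j <;> first | exact absurd rfl hij | skip
  all_goals fin_cases k <;> simp [pauli, ket, vecMulVec_apply]
  all_goals linear_combination p * h3 - p * h4

theorem sq_norm_corr_rhoUb {p q : ℝ} (hq : q ∈ Set.Icc (0 : ℝ) 1) {i j : Fin 2} (hij : i ≠ j) :
    ‖corr (rhoUb p q i j)‖ ^ 2 = (2 * p - 1) ^ 2 + 8 * p ^ 2 * (q * (1 - q)) := by
  have h3 := Real.sq_sqrt hq.1
  have h4 := Real.sq_sqrt (sub_nonneg.2 hq.2)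
  rw [EuclideanSpace.real_norm_sq_eq]
  simp only [corr, rhoUb, ketbra, phi, Matrix.trace, Matrix.diag, Matrix.mul_apply,
    Fintype.sum_prod_type, Fin.sum_univ_two, Fin.sum_univ_three, Matrix.kroneckerMap_apply]
  fin_cases i <;> fin_cases j <;> first | exact absurd rfl hij | skip
  all_goals simp [pauli, ket, vecMulVec_apply]
  all_goals ring_nf
  all_goals simp only [show √q ^ 4 = (√q ^ 2) ^ 2 by ring,
    show √(1 - q) ^ 4 = (√(1 - q) ^ 2) ^ 2 by ring, h3, h4]
  all_goals ring

/-! ### Attaining the bounds -/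

theorem norm_single_two (r : ℝ) :
    ‖(EuclideanSpace.single 2 r : EuclideanSpace ℝ (Fin 3))‖ = |r| := by
  simp

theorem upperBound_comm (x y : ℝ) : upperBound x y = upperBound y x := by
  rw [upperBound, upperBound, abs_sub_comm]; ring

/-- The value of the upper bound at the Bloch lengths `|m ± n|` of the extremal family, in the range
where it equals the squared correlation length. -/
theorem upperBound_abs_of_le {m n : ℝ} (hn : 0 ≤ n) (h : n ≤ |m|) :
    upperBound |m + n| |m - n| = (1 - 2 * n) ^ 2 + 2 * ((1 - n) ^ 2 - m ^ 2) := by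
  unfold upperBound
  rcases le_total 0 m with hm | hm
  · rw [abs_of_nonneg hm] at h
    rw [abs_of_nonneg (by linarith : 0 ≤ m + n), abs_of_nonneg (by linarith : 0 ≤ m - n),
      abs_of_nonneg (by linarith)]
    ring
  · rw [abs_of_nonpos hm] at h
    rw [abs_of_nonpos (by linarith : m + n ≤ 0), abs_of_nonpos (by linarith : m - n ≤ 0),
      abs_of_nonpos (by linarith)]
    ring

/-- In the range `|m| ≤ n` the gap to the squared correlation length of the extremal family is the
product `8 * (n - |m|) * (1 - n - |m|)`, whose zeros are the exceptional saturating parameters. -/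
theorem upperBound_abs_of_ge {m n : ℝ} (h : |m| ≤ n) :
    upperBound |m + n| |m - n| = (1 - 2 * n) ^ 2 + 2 * ((1 - n) ^ 2 - m ^ 2) +
      8 * (n - |m|) * (1 - n - |m|) := by
  unfold upperBound
  have h' := abs_le.1 h
  rw [abs_of_nonneg (by linarith : 0 ≤ m + n), abs_of_nonpos (by linarith : m - n ≤ 0)]
  rcases le_total 0 m with hm | hm
  · rw [abs_of_nonneg hm, abs_of_nonneg (by linarith)]
    ring
  · rw [abs_of_nonpos hm, abs_of_nonpos (by linarith)]
    ring

theorem upperBound_norm_rhoUb {p q : ℝ} (hq : q ∈ Set.Icc (0 : ℝ) 1) {i j : Fin 2} (hij : i ≠ j) :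
    upperBound ‖blochA (rhoUb p q i j)‖ ‖blochB (rhoUb p q i j)‖ =
      upperBound |p * (2 * q - 1) + (1 - p)| |p * (2 * q - 1) - (1 - p)| := by
  rw [blochA_rhoUb hq hij, blochB_rhoUb hq hij, norm_single_two, norm_single_two]
  fin_cases i
  · simp
  · rw [upperBound_comm]; simp [sub_eq_add_neg]

theorem sq_norm_corr_rhoUb_eq {p q : ℝ} (hq : q ∈ Set.Icc (0 : ℝ) 1) {i j : Fin 2} (hij : i ≠ j) :
    ‖corr (rhoUb p q i j)‖ ^ 2 = (1 - 2 * (1 - p)) ^ 2 +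
      2 * ((1 - (1 - p)) ^ 2 - (p * (2 * q - 1)) ^ 2) := by
  rw [sq_norm_corr_rhoUb hq hij]; ring

theorem abs_two_mul_sub_one (q : ℝ) : |2 * q - 1| = 2 * max q (1 - q) - 1 := by
  rcases le_total q (1 - q) with h | h
  · rw [max_eq_right h, abs_of_nonpos (by linarith)]; ring
  · rw [max_eq_left h, abs_of_nonneg (by linarith)]

theorem sq_norm_corr_rhoUb_eq_upperBound_iff {p q : ℝ} (hp : p ∈ Set.Icc (0 : ℝ) 1)
    (hq : q ∈ Set.Icc (0 : ℝ) 1) {i j : Fin 2} (hij : i ≠ j) :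
    ‖corr (rhoUb p q i j)‖ ^ 2 =
        upperBound ‖blochA (rhoUb p q i j)‖ ‖blochB (rhoUb p q i j)‖ ↔
      1 / 2 ≤ p * max q (1 - q) ∨ p = 0 ∨ q = 0 ∨ q = 1 := by
  rw [upperBound_norm_rhoUb hq hij, sq_norm_corr_rhoUb_eq hq hij]
  have hm : |p * (2 * q - 1)| = p * (2 * max q (1 - q) - 1) := by
    rw [abs_mul, abs_of_nonneg hp.1, abs_two_mul_sub_one]
  have hle : 1 - p ≤ |p * (2 * q - 1)| ↔ 1 / 2 ≤ p * max q (1 - q) := by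
    rw [hm]; constructor <;> intro h <;> linarith
  rcases le_or_gt (1 - p) |p * (2 * q - 1)| with h | h
  · exact iff_of_true (upperBound_abs_of_le (sub_nonneg.2 hp.2) h).symm (Or.inl (hle.1 h))
  · rw [upperBound_abs_of_ge h.le, left_eq_add, or_iff_right (mt hle.2 h.not_ge),
      mul_eq_zero, or_iff_right (by simpa [sub_eq_zero] using h.ne'), hm,
      show 1 - (1 - p) - p * (2 * max q (1 - q) - 1) = 2 * p * (1 - max q (1 - q)) by ring,
      mul_eq_zero, sub_eq_zero, mul_eq_zero, or_iff_right two_ne_zero]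
    refine or_congr Iff.rfl ⟨fun h1 => ?_, ?_⟩
    · rcases max_choice q (1 - q) with h2 | h2 <;> rw [h2] at h1
      · exact Or.inr h1.symm
      · exact Or.inl (by linarith)
    · rintro (rfl | rfl) <;> simp

theorem exists_rhoUb_param {m n : ℝ} (hn : n < 1) (h : |m| ≤ 1 - n) :
    ∃ q ∈ Set.Icc (0 : ℝ) 1, (1 - n) * (2 * q - 1) = m := by
  have h' := abs_le.1 h
  have hn' : 0 < 1 - n := by linarith
  refine ⟨(1 + m / (1 - n)) / 2, ⟨?_, ?_⟩, by field_simp; ring⟩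
  · have : -1 ≤ m / (1 - n) := by rw [le_div_iff₀ hn']; linarith
    linarith
  · have : m / (1 - n) ≤ 1 := by rw [div_le_iff₀ hn']; linarith
    linarith

/-- Here `n` is the weight of `|ij⟩` and `m` the contribution of `φ(q)` to both Bloch vectors, which
point along the third axis. -/
theorem exists_rhoUb_bloch {m n : ℝ} (hn0 : 0 ≤ n) (hn : n ≤ |m|) (h : |m| ≤ 1 - n)
    {i j : Fin 2} (hij : i ≠ j) :
    ∃ q ∈ Set.Icc (0 : ℝ) 1,
      blochA (rhoUb (1 - n) q i j) = EuclideanSpace.single 2 (m + n * (-1) ^ (i : ℕ)) ∧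
      blochB (rhoUb (1 - n) q i j) = EuclideanSpace.single 2 (m - n * (-1) ^ (i : ℕ)) ∧
      ‖corr (rhoUb (1 - n) q i j)‖ ^ 2 =
        upperBound ‖blochA (rhoUb (1 - n) q i j)‖ ‖blochB (rhoUb (1 - n) q i j)‖ := by
  obtain ⟨q, hq, hqm⟩ := exists_rhoUb_param (by linarith : n < 1) h
  refine ⟨q, hq, ?_, ?_, ?_⟩
  · rw [blochA_rhoUb hq hij, hqm, sub_sub_cancel]
  · rw [blochB_rhoUb hq hij, hqm, sub_sub_cancel]
  · rw [upperBound_norm_rhoUb hq hij, sq_norm_corr_rhoUb_eq hq hij, hqm, sub_sub_cancel,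
      upperBound_abs_of_le hn0 hn]

theorem exists_rhoUb_of_norms {x y : ℝ} (hx : x ∈ Set.Icc (0 : ℝ) 1) (hy : y ∈ Set.Icc (0 : ℝ) 1)
    {i j : Fin 2} (hij : i ≠ j) :
    ∃ p ∈ Set.Icc (0 : ℝ) 1, ∃ q ∈ Set.Icc (0 : ℝ) 1,
      ‖blochA (rhoUb p q i j)‖ = x ∧ ‖blochB (rhoUb p q i j)‖ = y ∧
      ‖corr (rhoUb p q i j)‖ ^ 2 = upperBound x y ∧
      (rhoUb p q i j).rank = if x = y then 1 else 2 := by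
  obtain ⟨hx0, hx1⟩ := hx
  obtain ⟨hy0, hy1⟩ := hy
  have hn1 : |x - y| ≤ 1 := abs_le.2 ⟨by linarith, by linarith⟩
  have hn0 := abs_nonneg (x - y)
  have hp : 1 - |x - y| / 2 ∈ Set.Icc (0 : ℝ) 1 := ⟨by linarith, by linarith⟩
  have hm : |(x + y) / 2| = (x + y) / 2 := abs_of_nonneg (by linarith)
  have hle : |x - y| / 2 ≤ (x + y) / 2 := by
    linarith [abs_le.2 (⟨by linarith, by linarith⟩ : -(x + y) ≤ x - y ∧ x - y ≤ x + y)]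
  have hle1 : (x + y) / 2 ≤ 1 - |x - y| / 2 := by
    rcases abs_cases (x - y) with h | h <;> linarith
  have hrank : ∀ q ∈ Set.Icc (0 : ℝ) 1,
      (rhoUb (1 - |x - y| / 2) q i j).rank = if x = y then 1 else 2 := by
    intro q hq
    rw [rank_rhoUb hp hq hij]
    rcases eq_or_ne x y with rfl | hxy
    · simp
    · have := abs_pos.2 (sub_ne_zero.2 hxy)
      rw [if_neg hxy, if_pos ⟨by linarith, by linarith⟩]
  -- The sign of `m` is the one that makes `m + n` and `m - n` equal to `± x` and `± y`.
  obtain ⟨m, hma, h1, h2⟩ : ∃ m : ℝ, |m| = (x + y) / 2 ∧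
      |m + |x - y| / 2 * (-1) ^ (i : ℕ)| = x ∧ |m - |x - y| / 2 * (-1) ^ (i : ℕ)| = y := by
    obtain ⟨e, he, hs⟩ : ∃ e : ℝ, (e = 1 ∨ e = -1) ∧
        |x - y| * (-1) ^ (i : ℕ) = e * (x - y) := by
      have hi : ((-1 : ℝ) ^ (i : ℕ) = 1) ∨ ((-1 : ℝ) ^ (i : ℕ) = -1) := neg_one_pow_eq_or _ _
      rcases abs_choice (x - y) with h | h <;> rcases hi with hi | hi <;> rw [h, hi]
      exacts [⟨1, by simp, by ring⟩, ⟨-1, by simp, by ring⟩, ⟨-1, by simp, by ring⟩,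
        ⟨1, by simp, by ring⟩]
    have he' : |e| = 1 := by rcases he with rfl | rfl <;> simp
    refine ⟨e * ((x + y) / 2), by rw [abs_mul, he', hm, one_mul], ?_, ?_⟩
    · rw [show e * ((x + y) / 2) + |x - y| / 2 * (-1) ^ (i : ℕ) = e * x by linarith,
        abs_mul, he', one_mul, abs_of_nonneg hx0]
    · rw [show e * ((x + y) / 2) - |x - y| / 2 * (-1) ^ (i : ℕ) = e * y by linarith,
        abs_mul, he', one_mul, abs_of_nonneg hy0]
  obtain ⟨q, hq, hA, hB, hT⟩ := exists_rhoUb_bloch (by linarith : 0 ≤ |x - y| / 2)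
    (hle.trans hma.ge) (hma.trans_le hle1) hij
  rw [hA, hB, norm_single_two, norm_single_two, h1, h2] at hT
  refine ⟨_, hp, q, hq, ?_, ?_, hT, hrank q hq⟩
  · rw [hA, norm_single_two, h1]
  · rw [hB, norm_single_two, h2]

/-- A state on the upper surface whose Bloch vectors point along the positive third axis. Depending
on which of `x`, `y` is larger, the product state mixed in is `|01⟩` or `|10⟩`. -/
theorem exists_isState_upper {x y : ℝ} (hx : x ∈ Set.Icc (0 : ℝ) 1) (hy : y ∈ Set.Icc (0 : ℝ) 1) :
    ∃ ρ : Op2, IsState ρ ∧ blochA ρ = EuclideanSpace.single 2 x ∧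
      blochB ρ = EuclideanSpace.single 2 y ∧ ‖corr ρ‖ ^ 2 = upperBound x y := by
  obtain ⟨hx0, hx1⟩ := hx
  obtain ⟨hy0, hy1⟩ := hy
  have hm : |(x + y) / 2| = (x + y) / 2 := abs_of_nonneg (by linarith)
  rcases le_total y x with h | h
  · obtain ⟨q, hq, hA, hB, hT⟩ := exists_rhoUb_bloch (m := (x + y) / 2) (n := (x - y) / 2)
      (by linarith) (by linarith) (by linarith) (show (0 : Fin 2) ≠ 1 by decide)
    rw [show (x + y) / 2 + (x - y) / 2 * (-1) ^ ((0 : Fin 2) : ℕ) = x by norm_num; ring] at hA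
    rw [show (x + y) / 2 - (x - y) / 2 * (-1) ^ ((0 : Fin 2) : ℕ) = y by norm_num; ring] at hB
    refine ⟨_, isState_rhoUb ⟨?_, ?_⟩ hq (by decide), hA, hB, ?_⟩
    · linarith
    · linarith
    · simpa [hA, hB, abs_of_nonneg hx0, abs_of_nonneg hy0] using hT
  · obtain ⟨q, hq, hA, hB, hT⟩ := exists_rhoUb_bloch (m := (x + y) / 2) (n := (y - x) / 2)
      (by linarith) (by linarith) (by linarith) (show (1 : Fin 2) ≠ 0 by decide)
    rw [show (x + y) / 2 + (y - x) / 2 * (-1) ^ ((1 : Fin 2) : ℕ) = x by norm_num; ring] at hA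
    rw [show (x + y) / 2 - (y - x) / 2 * (-1) ^ ((1 : Fin 2) : ℕ) = y by norm_num; ring] at hB
    refine ⟨_, isState_rhoUb ⟨?_, ?_⟩ hq (by decide), hA, hB, ?_⟩
    · linarith
    · linarith
    · simpa [hA, hB, abs_of_nonneg hx0, abs_of_nonneg hy0] using hT

/-- A state on the lower surface whose Bloch vectors point along the positive third axis: the
diagonal state with `t₃₃ = max 0 (x + y - 1)` and no other correlations. -/
theorem exists_isState_lower {x y : ℝ} (hx : x ∈ Set.Icc (0 : ℝ) 1) (hy : y ∈ Set.Icc (0 : ℝ) 1) :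
    ∃ ρ : Op2, IsState ρ ∧ blochA ρ = EuclideanSpace.single 2 x ∧
      blochB ρ = EuclideanSpace.single 2 y ∧ ‖corr ρ‖ = max 0 (x + y - 1) := by
  obtain ⟨hx0, hx1⟩ := hx
  obtain ⟨hy0, hy1⟩ := hy
  obtain ⟨t, ht⟩ : ∃ t, t = max 0 (x + y - 1) := ⟨_, rfl⟩
  have ht0 : 0 ≤ t := ht ▸ le_max_left _ _
  have ht1 : x + y - 1 ≤ t := ht ▸ le_max_right _ _
  have htx : t ≤ 1 - |x - y| := by
    rw [ht]; rcases abs_cases (x - y) with h | h <;> exact max_le (by linarith) (by linarith)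
  have htx' := abs_le.1 (le_sub_comm.1 htx)
  refine ⟨diagonal fun k => (((1 + (-1) ^ (k.1 : ℕ) * x + (-1) ^ (k.2 : ℕ) * y +
    (-1) ^ (k.1 : ℕ) * (-1) ^ (k.2 : ℕ) * t) / 4 : ℝ) : ℂ), ⟨?_, ?_⟩, ?_, ?_, ?_⟩
  · rw [posSemidef_diagonal_iff]
    rintro ⟨k, l⟩
    rw [Complex.zero_le_real]
    -- The four eigenvalues are nonnegative because `x + y - 1 ≤ t ≤ 1 - |x - y|`.
    fin_cases k <;> fin_cases l <;> simp <;> linarith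
  · simp [Fintype.sum_prod_type, Matrix.trace]
    ring
  · ext k
    simp only [blochA, Matrix.trace, Matrix.diag, Fintype.sum_prod_type, Fin.sum_univ_two,
      diagonal_mul, Matrix.kroneckerMap_apply]
    fin_cases k <;> simp [pauli]
    ring
  · ext k
    simp only [blochB, Matrix.trace, Matrix.diag, Fintype.sum_prod_type, Fin.sum_univ_two,
      diagonal_mul, Matrix.kroneckerMap_apply]
    fin_cases k <;> simp [pauli]
    ring
  · rw [← ht, ← sq_eq_sq₀ (norm_nonneg _) ht0, EuclideanSpace.real_norm_sq_eq]
    simp only [corr, Matrix.trace, Matrix.diag, Fintype.sum_prod_type, Fin.sum_univ_two,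
      Fin.sum_univ_three, diagonal_mul, Matrix.kroneckerMap_apply]
    simp [pauli]
    ring

theorem IsState.convexCombination {ρ τ : Op2} (hρ : IsState ρ) (hτ : IsState τ) {s : ℝ}
    (hs : s ∈ Set.Icc (0 : ℝ) 1) : IsState ((1 - s) • ρ + s • τ) := by
  refine ⟨?_, ?_⟩
  · exact (hρ.1.smul (sub_nonneg.2 hs.2)).add (hτ.1.smul hs.1)
  · rw [trace_add, trace_smul, trace_smul, hρ.2, hτ.2]
    simp

/-- The segment from a lower to an upper state with the same Bloch vectors keeps these vectors
fixed, while the correlation length takes every intermediate value. -/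
theorem exists_isState_of_le_of_le {x y z : ℝ} (hx : x ∈ Set.Icc (0 : ℝ) 1)
    (hy : y ∈ Set.Icc (0 : ℝ) 1) (hz : max 0 (x + y - 1) ≤ z) (hzU : z ^ 2 ≤ upperBound x y) :
    ∃ ρ : Op2, IsState ρ ∧ ‖blochA ρ‖ = x ∧ ‖blochB ρ‖ = y ∧ ‖corr ρ‖ = z := by
  obtain ⟨ρ, hρ, hρA, hρB, hρT⟩ := exists_isState_lower hx hy
  obtain ⟨τ, hτ, hτA, hτB, hτT⟩ := exists_isState_upper hx hy
  have hcont : Continuous fun s : ℝ => ‖corr ((1 - s) • ρ + s • τ)‖ := by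
    simp only [corr_add, corr_smul]
    fun_prop
  have hzτ : z ≤ ‖corr τ‖ := by
    rw [← hτT] at hzU
    exact le_of_sq_le_sq hzU (norm_nonneg _)
  obtain ⟨s, hs, hsz⟩ := intermediate_value_Icc zero_le_one hcont.continuousOn
    (show z ∈ Set.Icc _ _ from ⟨by simpa [hρT] using hz, by simpa using hzτ⟩)
  refine ⟨_, hρ.convexCombination hτ hs, ?_, ?_, hsz⟩
  · rw [blochA_add, blochA_smul, blochA_smul, hρA, hτA, ← add_smul, sub_add_cancel, one_smul,
      norm_single_two, abs_of_nonneg hx.1]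
  · rw [blochB_add, blochB_smul, blochB_smul, hρB, hτB, ← add_smul, sub_add_cancel, one_smul,
      norm_single_two, abs_of_nonneg hy.1]

/-- On the region defined by the two surfaces the coordinates `x`, `y` are automatically at most
one: for `y ≤ x` one has `U - (x + y - 1)² = 2 (1 - x) (1 + 3 y)`. -/
theorem le_one_of_le_upperBound {x y z : ℝ} (hy : 0 ≤ y) (hz : 0 ≤ z) (h : x + y - 1 ≤ z)
    (hU : z ^ 2 ≤ upperBound x y) (hxy : y ≤ x) : x ≤ 1 := by
  by_contra! h1
  rw [upperBound, abs_of_nonneg (sub_nonneg.2 hxy)] at hU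
  nlinarith [mul_nonneg (sub_nonneg.2 h1.le) hy]

theorem blochBody_eq : blochBody = {v : ℝ × ℝ × ℝ | 0 ≤ v.1 ∧ 0 ≤ v.2.1 ∧ 0 ≤ v.2.2 ∧
    v.1 + v.2.1 - 1 ≤ v.2.2 ∧ v.2.2 ^ 2 ≤ upperBound v.1 v.2.1} := by
  ext ⟨x, y, z⟩
  constructor
  · rintro ⟨ρ, hρ, h⟩
    rw [h]
    exact ⟨norm_nonneg _, norm_nonneg _, norm_nonneg _, hρ.add_sub_one_le_norm_corr,
      hρ.sq_norm_corr_le⟩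
  · rintro ⟨hx, hy, hz, hlow, hup⟩
    simp only at hx hy hz hlow hup
    have h1 : x ≤ 1 ∧ y ≤ 1 := by
      rcases le_total y x with h | h
      · have := le_one_of_le_upperBound hy hz hlow hup h
        exact ⟨this, h.trans this⟩
      · have := le_one_of_le_upperBound hx hz (by linarith) (upperBound_comm x y ▸ hup) h
        exact ⟨h.trans this, this⟩
    obtain ⟨ρ, hρ, rfl, rfl, rfl⟩ := exists_isState_of_le_of_le ⟨hx, h1.1⟩ ⟨hy, h1.2⟩
      (max_le hz hlow) hup
    exact ⟨ρ, hρ, rfl⟩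

/-! ### Prescribed marginals -/

/-- The diagonal qubit state with Bloch vector `(0, 0, r)`. -/
noncomputable def qubitDiag (r : ℝ) : Op1 :=
  diagonal ![(((1 + r) / 2 : ℝ) : ℂ), (((1 - r) / 2 : ℝ) : ℂ)]

/-- A trace-one Hermitian operator on a qubit is determined by its Bloch vector. -/
theorem eq_qubitDiag {A : Op1} (hA : A.IsHermitian) (ht : A.trace = 1) {r : ℝ}
    (h : bloch A = EuclideanSpace.single 2 r) : A = qubitDiag r := by
  have h0 := congrArg (fun v : EuclideanSpace ℝ (Fin 3) => v 0) h
  have h1 := congrArg (fun v : EuclideanSpace ℝ (Fin 3) => v 1) h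
  have h2 := congrArg (fun v : EuclideanSpace ℝ (Fin 3) => v 2) h
  have e01 := hA.apply 0 1
  have e00 := hA.apply 0 0
  have e11 := hA.apply 1 1
  rw [Matrix.trace_fin_two] at ht
  simp [bloch, pauli, Matrix.trace_fin_two, Matrix.mul_apply, Fin.sum_univ_two] at h0 h1 h2
  rw [Complex.ext_iff] at e01 e00 e11 ht
  simp at e01 e00 e11 ht
  ext i j
  rw [qubitDiag]
  fin_cases i <;> fin_cases j <;> apply Complex.ext <;> simp <;> linarith

theorem sq_norm_bloch_eq {A : Op1} (hA : A.IsHermitian) :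
    ‖bloch A‖ ^ 2 = 2 * (A * A).trace.re - A.trace.re ^ 2 := by
  have e01 := hA.apply 0 1
  have e00 := hA.apply 0 0
  have e11 := hA.apply 1 1
  rw [Complex.ext_iff] at e01 e00 e11
  simp at e01 e00 e11
  have d0 : (A 0 0).im = 0 := by linarith
  have d1 : (A 1 1).im = 0 := by linarith
  rw [sq_norm_bloch]
  simp [Matrix.trace_fin_two, Matrix.mul_apply, Fin.sum_univ_two, d0, d1, ← e01.1, ← e01.2]
  ring

/-- Any qubit state is unitarily equivalent to a diagonal one with the same Bloch length. -/
theorem IsState.exists_conj_qubitDiag {A : Op1} (h : IsState A) :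
    ‖bloch A‖ ≤ 1 ∧ ∃ U : Op1, Uᴴ * U = 1 ∧ A = U * qubitDiag ‖bloch A‖ * Uᴴ := by
  obtain ⟨hp, ht⟩ := h
  have hU := (Unitary.mem_iff.1 hp.1.eigenvectorUnitary.2).1
  have hs := hp.1.spectral_theorem
  rw [Unitary.conjStarAlgAut_apply] at hs
  have hl := hp.eigenvalues_nonneg
  generalize (hp.1.eigenvectorUnitary : Op1) = U at hU hs
  generalize hp.1.eigenvalues = l at hs hl
  rw [star_eq_conjTranspose] at hU hs
  have hl0 := hl 0
  have hl1 := hl 1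
  have hsum : l 0 + l 1 = 1 := by
    rw [hs, trace_mul_comm, ← mul_assoc, hU, one_mul, trace_fin_two] at ht
    simp at ht
    exact_mod_cast ht
  have hr : ‖bloch A‖ = |l 0 - l 1| := by
    rw [← sq_eq_sq₀ (norm_nonneg _) (abs_nonneg _), sq_norm_bloch_eq hp.1, sq_abs, ht, hs,
      trace_conj_mul_conj hU, trace_fin_two]
    simp
    linear_combination (l 0 + l 1 + 1) * hsum
  refine ⟨hr ▸ abs_le.2 ⟨by linarith, by linarith⟩, ?_⟩
  rw [hr]
  rcases le_total (l 1) (l 0) with hle | hle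
  · refine ⟨U, hU, ?_⟩
    conv_lhs => rw [hs]
    congr 2
    ext i j
    rw [abs_of_nonneg (sub_nonneg.2 hle), qubitDiag]
    have h0 : (1 + (l 0 - l 1)) / 2 = l 0 := by linarith
    have h1 : (1 - (l 0 - l 1)) / 2 = l 1 := by linarith
    rw [h0, h1]
    fin_cases i <;> fin_cases j <;> simp
  · -- The Pauli matrix `σ_x` exchanges the two eigenvectors.
    have hX : (pauli 0)ᴴ * pauli 0 = 1 := by
      ext i j
      fin_cases i <;> fin_cases j <;> simp [pauli, Matrix.mul_apply]
    refine ⟨U * pauli 0, ?_, ?_⟩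
    · rw [conjTranspose_mul, mul_assoc, ← mul_assoc _ U, hU, one_mul, hX]
    · conv_lhs => rw [hs]
      have hD : diagonal (RCLike.ofReal ∘ l) = pauli 0 * qubitDiag |l 0 - l 1| * (pauli 0)ᴴ := by
        ext i j
        rw [abs_of_nonpos (sub_nonpos.2 hle), qubitDiag]
        have h0 : (1 + -(l 0 - l 1)) / 2 = l 1 := by linarith
        have h1 : (1 - -(l 0 - l 1)) / 2 = l 0 := by linarith
        rw [h0, h1]
        fin_cases i <;> fin_cases j <;> simp [pauli, Matrix.mul_apply, vecMul_diagonal]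
      rw [hD, conjTranspose_mul]
      noncomm_ring

theorem traceB_conj_kronecker (U : Op1) {V : Op1} (hV : Vᴴ * V = 1) (ρ : Op2) :
    traceB ((U ⊗ₖ V) * ρ * (U ⊗ₖ V)ᴴ) = U * traceB ρ * Uᴴ := by
  have h : ∀ d b, ∑ k, star (V k d) * V k b = (1 : Op1) d b := fun d b => by
    rw [← hV]; simp [Matrix.mul_apply]
  ext i j
  -- The sum over the index of `B` produces the entries of `Vᴴ * V`.
  have h' : ∀ b d, (∑ a, ∑ e, U i a * ρ (a, b) (e, d) * star (U j e)) *
      (∑ k, star (V k d) * V k b) = (∑ a, ∑ e, U i a * ρ (a, b) (e, d) * star (U j e)) *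
      (1 : Op1) d b := fun b d => by rw [h]
  have h00 := h' 0 0
  have h01 := h' 0 1
  have h10 := h' 1 0
  have h11 := h' 1 1
  simp only [traceB, Matrix.mul_apply, Fintype.sum_prod_type, Fin.sum_univ_two, of_apply,
    kroneckerMap_apply, conjTranspose_apply, star_mul', one_apply, ↓reduceIte, zero_ne_one,
    one_ne_zero] at h00 h01 h10 h11 ⊢
  linear_combination h00 + h01 + h10 + h11

theorem traceA_conj_kronecker {U : Op1} (V : Op1) (hU : Uᴴ * U = 1) (ρ : Op2) :
    traceA ((U ⊗ₖ V) * ρ * (U ⊗ₖ V)ᴴ) = V * traceA ρ * Vᴴ := by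
  have h : ∀ d b, ∑ k, star (U k d) * U k b = (1 : Op1) d b := fun d b => by
    rw [← hU]; simp [Matrix.mul_apply]
  ext i j
  -- The sum over the index of `A` produces the entries of `Uᴴ * U`.
  have h' : ∀ b d, (∑ a, ∑ e, V i a * ρ (b, a) (d, e) * star (V j e)) *
      (∑ k, star (U k d) * U k b) = (∑ a, ∑ e, V i a * ρ (b, a) (d, e) * star (V j e)) *
      (1 : Op1) d b := fun b d => by rw [h]
  have h00 := h' 0 0
  have h01 := h' 0 1
  have h10 := h' 1 0
  have h11 := h' 1 1
  simp only [traceA, Matrix.mul_apply, Fintype.sum_prod_type, Fin.sum_univ_two, of_apply,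
    kroneckerMap_apply, conjTranspose_apply, star_mul', one_apply, ↓reduceIte, zero_ne_one,
    one_ne_zero] at h00 h01 h10 h11 ⊢
  linear_combination h00 + h01 + h10 + h11

theorem isHermitian_traceB {ρ : Op2} (h : ρ.IsHermitian) : (traceB ρ).IsHermitian := by
  ext i j
  simp [traceB, h.apply]

theorem isHermitian_traceA {ρ : Op2} (h : ρ.IsHermitian) : (traceA ρ).IsHermitian := by
  ext i j
  simp [traceA, h.apply]

theorem trace_traceB (ρ : Op2) : (traceB ρ).trace = ρ.trace := by
  simp [traceB, Matrix.trace, Fintype.sum_prod_type]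

theorem trace_traceA (ρ : Op2) : (traceA ρ).trace = ρ.trace := by
  simp [traceA, Matrix.trace, Fintype.sum_prod_type]
  ring

theorem purityBound_two (Δ : ℝ) : purityBound 2 Δ = 2 - 2 * Δ + Δ ^ 2 := by
  have h : √(2 * (2 : ℝ)) = 2 := by
    rw [← pow_two, Real.sqrt_sq zero_le_two]
  simp [purityBound, h]

/-- The extremal states have marginals diagonal in the computational basis. Local unitaries carry
these to arbitrary marginals of the same Bloch lengths and do not change the purity. -/
theorem exists_purity_eq {A B : Op1} (hA : IsState A) (hB : IsState B) :
    ∃ ρ : Op2, IsState ρ ∧ traceB ρ = A ∧ traceA ρ = B ∧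
      2 * purity ρ = purityBound 2 |‖bloch A‖ - ‖bloch B‖| := by
  obtain ⟨hA1, U, hU, hAU⟩ := hA.exists_conj_qubitDiag
  obtain ⟨hB1, V, hV, hBV⟩ := hB.exists_conj_qubitDiag
  obtain ⟨τ, hτ, hτA, hτB, hτT⟩ :=
    exists_isState_upper ⟨norm_nonneg (bloch A), hA1⟩ ⟨norm_nonneg (bloch B), hB1⟩
  have hUV : (U ⊗ₖ V)ᴴ * (U ⊗ₖ V) = 1 := by
    rw [conjTranspose_kronecker, ← mul_kronecker_mul, hU, hV, one_kronecker_one]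
  refine ⟨(U ⊗ₖ V) * τ * (U ⊗ₖ V)ᴴ, ⟨hτ.1.mul_mul_conjTranspose_same _, ?_⟩, ?_, ?_, ?_⟩
  · rw [trace_mul_comm, ← mul_assoc, hUV, one_mul, hτ.2]
  · rw [traceB_conj_kronecker U hV, eq_qubitDiag (isHermitian_traceB hτ.1.1)
      ((trace_traceB τ).trans hτ.2) ((bloch_traceB τ).trans hτA), ← hAU]
  · rw [traceA_conj_kronecker V hU, eq_qubitDiag (isHermitian_traceA hτ.1.1)
      ((trace_traceA τ).trans hτ.2) ((bloch_traceA τ).trans hτB), ← hBV]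
  · have h := four_mul_purity hτ.1.1
    rw [hτA, hτB, hτT, hτ.2, norm_single_two, norm_single_two, abs_norm, abs_norm, upperBound,
      Complex.one_re] at h
    rw [purity, trace_conj_mul_conj hUV, ← purity, purityBound_two, sq_abs]
    linarith

end TwoQubit

theorem mainTheorem2 :
    -- the attainable triples
    (TwoQubit.blochBody =
      {v : ℝ × ℝ × ℝ | 0 ≤ v.1 ∧ 0 ≤ v.2.1 ∧ 0 ≤ v.2.2 ∧
        v.1 + v.2.1 - 1 ≤ v.2.2 ∧ v.2.2 ^ 2 ≤ TwoQubit.upperBound v.1 v.2.1}) ∧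
    -- the family of states, its rank, and the parameters for which it saturates the upper bound
    (∀ i j : Fin 2, i ≠ j → ∀ p ∈ Set.Icc (0 : ℝ) 1, ∀ q ∈ Set.Icc (0 : ℝ) 1,
      TwoQubit.IsState (TwoQubit.rhoUb p q i j) ∧
      ((TwoQubit.rhoUb p q i j).rank = 2 ↔ 0 < p ∧ p < 1) ∧
      (‖TwoQubit.corr (TwoQubit.rhoUb p q i j)‖ ^ 2 =
          TwoQubit.upperBound ‖TwoQubit.blochA (TwoQubit.rhoUb p q i j)‖
            ‖TwoQubit.blochB (TwoQubit.rhoUb p q i j)‖ ↔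
        1 / 2 ≤ p * max q (1 - q) ∨ p = 0 ∨ q = 0 ∨ q = 1)) ∧
    -- the family covers the whole upper surface
    (∀ i j : Fin 2, i ≠ j → ∀ x ∈ Set.Icc (0 : ℝ) 1, ∀ y ∈ Set.Icc (0 : ℝ) 1,
      ∃ p ∈ Set.Icc (0 : ℝ) 1, ∃ q ∈ Set.Icc (0 : ℝ) 1,
        ‖TwoQubit.blochA (TwoQubit.rhoUb p q i j)‖ = x ∧
        ‖TwoQubit.blochB (TwoQubit.rhoUb p q i j)‖ = y ∧
        ‖TwoQubit.corr (TwoQubit.rhoUb p q i j)‖ ^ 2 = TwoQubit.upperBound x y ∧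
        (TwoQubit.rhoUb p q i j).rank = if x = y then 1 else 2) ∧
    -- the purity bound holds and is attained for every pair of marginal states
    (∀ ρA ρB : TwoQubit.Op1, TwoQubit.IsState ρA → TwoQubit.IsState ρB →
      IsGreatest
        {r : ℝ | ∃ ρ : TwoQubit.Op2, TwoQubit.IsState ρ ∧ TwoQubit.traceB ρ = ρA ∧
          TwoQubit.traceA ρ = ρB ∧ r = 2 * TwoQubit.purity ρ}
        (TwoQubit.purityBound 2 |‖TwoQubit.bloch ρA‖ - ‖TwoQubit.bloch ρB‖|)) := by
  refine ⟨TwoQubit.blochBody_eq, fun i j hij p hp q hq => ⟨TwoQubit.isState_rhoUb hp hq hij, ?_,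
    TwoQubit.sq_norm_corr_rhoUb_eq_upperBound_iff hp hq hij⟩, fun i j hij x hx y hy =>
    TwoQubit.exists_rhoUb_of_norms hx hy hij, fun ρA ρB hA hB => ⟨?_, ?_⟩⟩
  · rw [TwoQubit.rank_rhoUb hp hq hij]
    split_ifs with h <;> simp [h]
  · obtain ⟨ρ, hρ, h1, h2, h3⟩ := TwoQubit.exists_purity_eq hA hB
    exact ⟨ρ, hρ, h1, h2, h3.symm⟩
  · rintro r ⟨ρ, hρ, rfl, rfl, rfl⟩
    rw [TwoQubit.purityBound_two, TwoQubit.bloch_traceB, TwoQubit.bloch_traceA]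
    exact hρ.two_mul_purity_le
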